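/- All digraphs are finite and simple (no loops, no multiple arcs). For a strongly connected digraph $G$ on vertices $v_1,\dots,v_n$ let $d_{ij}$ be the length of a shortest directed path from $v_i$ to $v_j$, $D(G)=(d_{ij})$ the distance matrix, and $\mathrm{Diag}(Tr)$ the diagonal matrix with entries $D_i=\sum_{j} d_{ij}$. For real $\alpha$ let $D_\alpha(G)=\alpha\,\mathrm{Diag}(Tr)+(1-\alpha)D(G)$ and let $\mu_\alpha(G)$ be the spectral radius (the largest modulus of a complex eigenvalue) of $D_\alpha(G)$. The arc connectivity of $G$ is the minimum number of arcs whose deletion makes $G$ not strongly connected. For $1\le k\le n-2$ and $1\le m\le n-k-1$, let $K(n,k,m)$ be the digraph obtained from the join of the complete digraph $\overleftrightarrow{K}_k$ with the disjoint union $\overleftrightarrow{K}_{n-k-m}\cup\overleftrightarrow{K}_m$ (the join adds all arcs in both directions between its two parts) by adding all arcs $(u,v)$ with $u\in V(\overleftrightarrow{K}_m)$ and $v\in V(\overleftrightarrow{K}_{n-k-m})$. Theorem 5.4. Let $1\le k\le n-2$ and let $G$ be a strongly connected digraph of order $n$ with arc connectivity $k$. Then: (i) for $\alpha=0$, $\mu_0(G)\ge\mu_0(K(n,k,1))=\mu_0(K(n,k,n-k-1))$,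 and $\mu_0(G)=\mu_0(K(n,k,1))$ if and only if $G\cong K(n,k,n-k-1)$ or $G\cong K(n,k,1)$; (ii) for every real $\alpha$ with $0<\alpha<1$, $\mu_\alpha(G)\ge\mu_\alpha(K(n,k,1))$, with equality if and only if $G\cong K(n,k,1)$. -/

import Mathlib

/-! Digraphs, distances, the matrix `D_α`, arc connectivity, and the digraphs `K(n, k, m)`. -/

namespace Digraph

/-- A digraph is simple if it has no loops (multiple arcs are impossible for a relation). -/
def IsSimple {V : Type*} (G : Digraph V) : Prop :=
  ∀ v, ¬ G.Adj v v

/-- `G.HasWalk u v ℓ`: there is a directed walk of length `ℓ` from `u` to `v` in `G`. -/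
inductive HasWalk {V : Type*} (G : Digraph V) : V → V → ℕ → Prop
  | nil (u : V) : HasWalk G u u 0
  | cons {u v w : V} {l : ℕ} (h : G.Adj u v) (p : HasWalk G v w l) : HasWalk G u w (l + 1)

/-- Every vertex can be reached from every vertex along arcs. -/
def StronglyConnected {V : Type*} (G : Digraph V) : Prop :=
  ∀ u v, ∃ l, G.HasWalk u v l

/-- The distance from `u` to `v`: the length of a shortest directed path, equivalently of a
shortest directed walk (a shortest walk repeats no vertex). The value is `0` if `v` is not
reachable from `u`. -/
noncomputable def dist {V : Type*} (G : Digraph V) (u v : V) : ℕ :=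
  sInf {l | G.HasWalk u v l}

/-- The digraph `G - S` obtained by deleting the arcs in `S`. -/
def deleteArcs {V : Type*} (G : Digraph V) (S : Finset (V × V)) : Digraph V where
  Adj u v := G.Adj u v ∧ (u, v) ∉ S

/-- `S` is an arc cut set: a set of arcs of `G` such that `G - S` is not strongly connected. -/
def IsArcCut {V : Type*} (G : Digraph V) (S : Finset (V × V)) : Prop :=
  (∀ e ∈ S, G.Adj e.1 e.2) ∧ ¬ (G.deleteArcs S).StronglyConnected

/-- The arc connectivity: the minimum number of arcs in an arc cut set (`0` if there is none,
which for finite digraphs happens only on at most one vertex). -/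
noncomputable def arcConnectivity {V : Type*} (G : Digraph V) : ℕ :=
  sInf {c | ∃ S : Finset (V × V), G.IsArcCut S ∧ S.card = c}

/-- Isomorphism of digraphs. -/
def IsIsomorphic {V W : Type*} (G : Digraph V) (H : Digraph W) : Prop :=
  Nonempty (G.Adj ≃r H.Adj)

/-- The distance matrix `D(G)`. -/
noncomputable def distMatrix {V : Type*} (G : Digraph V) : Matrix V V ℝ :=
  Matrix.of fun u v => (G.dist u v : ℝ)

/-- The transmission of `u`: the sum of the distances from `u` to all vertices. -/
noncomputable def transmission {V : Type*} [Fintype V] (G : Digraph V) (u : V) : ℝ :=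
  ∑ v, (G.dist u v : ℝ)

/-- `D_α(G) = α Diag(Tr) + (1 - α) D(G)`. -/
noncomputable def genDistMatrix {V : Type*} [Fintype V] [DecidableEq V] (α : ℝ)
    (G : Digraph V) : Matrix V V ℝ :=
  α • Matrix.diagonal G.transmission + (1 - α) • G.distMatrix

/-- `μ_α(G)`: the spectral radius of `D_α(G)`, i.e. the largest modulus of its complex
eigenvalues. -/
noncomputable def genDistRadius {V : Type*} [Fintype V] [DecidableEq V] (α : ℝ)
    (G : Digraph V) : ℝ :=
  (spectralRadius ℂ ((genDistMatrix α G).map (fun x : ℝ => (x : ℂ)))).toReal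

/-- The complete (loopless) digraph on `V`: an arc `(u, v)` for all distinct `u`, `v`. -/
def loopFreeComplete (V : Type*) : Digraph V where
  Adj u v := u ≠ v

/-- The disjoint union of two digraphs. -/
def disjUnion {V W : Type*} (G : Digraph V) (H : Digraph W) : Digraph (V ⊕ W) where
  Adj
    | .inl u, .inl v => G.Adj u v
    | .inr u, .inr v => H.Adj u v
    | .inl _, .inr _ => False
    | .inr _, .inl _ => False

/-- The join of two digraphs: the disjoint union with all arcs in both directions between the
two vertex sets. -/
def join {V W : Type*} (G : Digraph V) (H : Digraph W) : Digraph (V ⊕ W) where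
  Adj
    | .inl u, .inl v => G.Adj u v
    | .inr u, .inr v => H.Adj u v
    | .inl _, .inr _ => True
    | .inr _, .inl _ => True

/-- The digraph `K(n, k, m)` for `1 ≤ m ≤ n - k - 1`: the join of the complete digraph on `k`
vertices with the disjoint union of the complete digraphs on `n - k - m` and on `m` vertices,
together with all arcs from the complete digraph on `m` vertices to the one on `n - k - m`
vertices. -/
def K (n k m : ℕ) : Digraph (Fin k ⊕ (Fin (n - k - m) ⊕ Fin m)) :=
  join (loopFreeComplete (Fin k))
      (disjUnion (loopFreeComplete (Fin (n - k - m))) (loopFreeComplete (Fin m)))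
    ⊔ { Adj := fun u v => ∃ i j, u = .inr (.inr i) ∧ v = .inr (.inl j) }

end Digraph

/-! A minimum arc cut of `G` can be turned into `k` vertices whose removal leaves two nonempty parts
with no arc from the first to the second. Hence `G` is a spanning subdigraph of some `K(n, k, m)`
(`exists_equiv_K`). Since `K(n, k, m)` has diameter at most 2, distances in `G` dominate those in
`K(n, k, m)`, and Perron-Frobenius comparison with a positive eigenvector gives `μ_α(G) ≥ μ_α(K(n,
k, m))`, strictly unless all distances agree (`StronglyConnected.le_genDistRadius`).

It remains to compare the `K(n, k, m)`. Their radius is `n - 1 + t`, with `t` the positive root of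
`t² + ((1-α)n - αm)t = (1-α)m(n-k-m)` (`genDistRadius_K`). The linear coefficient is largest at `m =
1` and the right side is smallest at `m = 1` and `m = n-k-1`, so `m = 1` minimizes `t`
(`pos_root_le`). For `α = 0` only the right side depends on `m`, which explains the second
minimizer. -/

open scoped Matrix

/-! ### Collatz-Wielandt bounds for nonnegative matrices -/

open Filter Topology in
/-- A nonnegative matrix with `ρ x ≤ M x` for a positive vector `x` has spectral radius at
least `ρ`. -/
theorem Matrix.le_spectralRadius_of_smul_le_mulVec {V : Type*} [Fintype V] [DecidableEq V]
    [Nonempty V] {M : Matrix V V ℝ} (hM : ∀ i j, 0 ≤ M i j) {x : V → ℝ} (hx : ∀ i, 0 < x i)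
    {ρ : ℝ} (hρ : 0 ≤ ρ) (h : ∀ i, ρ * x i ≤ (M *ᵥ x) i) :
    ENNReal.ofReal ρ ≤ spectralRadius ℂ (M.map (fun r : ℝ => (r : ℂ))) := by
  let _ : NormedRing (Matrix V V ℂ) := Matrix.linftyOpNormedRing
  let _ : NormedAlgebra ℂ (Matrix V V ℂ) := Matrix.linftyOpNormedAlgebra
  have hpow : ∀ j : ℕ, ∀ i, ρ ^ j * x i ≤ ((M ^ j) *ᵥ x) i := by
    intro j
    induction j with
    | zero => simp
    | succ j ih =>
      intro i
      rw [pow_succ' M, ← Matrix.mulVec_mulVec]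
      calc ρ ^ (j + 1) * x i = ρ ^ j * (ρ * x i) := by ring
        _ ≤ ρ ^ j * (M *ᵥ x) i := by gcongr; exact h i
        _ = ∑ l, M i l * (ρ ^ j * x l) := by
          simp only [Matrix.mulVec, dotProduct, Finset.mul_sum]
          exact Finset.sum_congr rfl fun l _ => by ring
        _ ≤ _ := Finset.sum_le_sum fun l _ => mul_le_mul_of_nonneg_left (ih l) (hM i l)
  obtain ⟨i₀, hi₀⟩ := Finite.exists_max x
  have hnorm : ‖fun i => (x i : ℂ)‖ ≤ x i₀ := by
    refine (pi_norm_le_iff_of_nonneg (hx i₀).le).2 fun i => ?_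
    rw [Complex.norm_real, Real.norm_of_nonneg (hx i).le]
    exact hi₀ i
  have hle : ∀ j : ℕ, ρ ^ j ≤ ‖(M.map (fun r : ℝ => (r : ℂ))) ^ j‖ := by
    intro j
    have e1 : (M.map (fun r : ℝ => (r : ℂ))) ^ j = (M ^ j).map (fun r : ℝ => (r : ℂ)) :=
      (map_pow Complex.ofRealHom.mapMatrix M j).symm
    have e2 : (((M ^ j).map (fun r : ℝ => (r : ℂ))) *ᵥ (fun i => (x i : ℂ))) i₀ =
        (((M ^ j *ᵥ x) i₀ : ℝ) : ℂ) :=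
      (RingHom.map_mulVec Complex.ofRealHom (M ^ j) x i₀).symm
    have h1 : ρ ^ j * x i₀ ≤
        ‖((M.map (fun r : ℝ => (r : ℂ))) ^ j) *ᵥ (fun i => (x i : ℂ))‖ := by
      refine le_trans ?_ (norm_le_pi_norm _ i₀)
      rw [e1, e2, Complex.norm_real]
      exact (hpow j i₀).trans (le_abs_self _)
    have h2 := Matrix.linfty_opNorm_mulVec ((M.map (fun r : ℝ => (r : ℂ))) ^ j)
      (fun i => (x i : ℂ))
    have h3 := mul_le_mul_of_nonneg_left hnorm (norm_nonneg ((M.map (fun r : ℝ => (r : ℂ))) ^ j))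
    exact le_of_mul_le_mul_right (h1.trans (h2.trans h3)) (hx i₀)
  -- Gelfand's formula turns the bound on the norms of all powers into a bound on the spectral
  -- radius.
  refine ge_of_tendsto (spectrum.pow_norm_pow_one_div_tendsto_nhds_spectralRadius
    (M.map (fun r : ℝ => (r : ℂ)))) ?_
  filter_upwards [eventually_ge_atTop 1] with j hj
  apply ENNReal.ofReal_le_ofReal
  calc ρ = (ρ ^ j) ^ (1 / j : ℝ) := by
        rw [one_div, Real.pow_rpow_inv_natCast hρ (by omega)]
    _ ≤ _ := Real.rpow_le_rpow (by positivity) (hle j) (by positivity)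

/-- A nonnegative matrix with `M x ≤ ρ x` for a positive vector `x` has spectral radius at
most `ρ`. -/
theorem Matrix.spectralRadius_le_of_mulVec_le {V : Type*} [Fintype V] [DecidableEq V]
    {M : Matrix V V ℝ} (hM : ∀ i j, 0 ≤ M i j) {x : V → ℝ} (hx : ∀ i, 0 < x i)
    {ρ : ℝ} (h : ∀ i, (M *ᵥ x) i ≤ ρ * x i) :
    spectralRadius ℂ (M.map (fun r : ℝ => (r : ℂ))) ≤ ENNReal.ofReal ρ := by
  refine iSup₂_le fun l hl => ?_
  rw [← Matrix.spectrum_toLin', ← Module.End.hasEigenvalue_iff_mem_spectrum] at hl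
  obtain ⟨z, hz⟩ := hl.exists_hasEigenvector
  have hz0 := hz.2
  have hzl := hz.apply_eq_smul
  rw [Matrix.toLin'_apply] at hzl
  obtain ⟨i₁, hi₁⟩ := Function.ne_iff.1 hz0
  rw [Pi.zero_apply] at hi₁
  have : Nonempty V := ⟨i₁⟩
  -- At the row where `‖z i‖ / x i` is largest, the triangle inequality in the eigenvalue equation
  -- gives `‖l‖ ≤ ρ`.
  obtain ⟨i₀, hi₀⟩ := Finite.exists_max (fun i => ‖z i‖ / x i)
  set c := ‖z i₀‖ / x i₀ with hc
  have hcpos : 0 < c := (div_pos (norm_pos_iff.2 hi₁) (hx i₁)).trans_le (hi₀ i₁)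
  have hzc : ∀ i, ‖z i‖ ≤ c * x i := fun i => (div_le_iff₀ (hx i)).1 (hi₀ i)
  have hz₀ : ‖z i₀‖ = c * x i₀ := by rw [hc, div_mul_cancel₀ _ (hx i₀).ne']
  have key : ‖l‖ * (c * x i₀) ≤ ρ * (c * x i₀) := by
    calc ‖l‖ * (c * x i₀) = ‖(l • z) i₀‖ := by rw [Pi.smul_apply, norm_smul, hz₀]
      _ = ‖∑ j, (M i₀ j : ℂ) * z j‖ := by rw [← hzl]; rfl
      _ ≤ ∑ j, M i₀ j * (c * x j) := by
        refine (norm_sum_le _ _).trans (Finset.sum_le_sum fun j _ => ?_)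
        rw [norm_mul, Complex.norm_real, Real.norm_of_nonneg (hM i₀ j)]
        exact mul_le_mul_of_nonneg_left (hzc j) (hM i₀ j)
      _ = c * (M *ᵥ x) i₀ := by
        simp only [Matrix.mulVec, dotProduct, Finset.mul_sum]
        exact Finset.sum_congr rfl fun l _ => by ring
      _ ≤ c * (ρ * x i₀) := by gcongr; exact h i₀
      _ = ρ * (c * x i₀) := by ring
  have hlr : ‖l‖ ≤ ρ := le_of_mul_le_mul_right key (mul_pos hcpos (hx i₀))
  change ‖l‖ₑ ≤ _
  rw [← ofReal_norm]
  exact ENNReal.ofReal_le_ofReal hlr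

/-- Needed so that `toReal` in `genDistRadius` preserves inequalities; the constant vector is the
test vector. -/
theorem Matrix.spectralRadius_map_ofReal_ne_top {V : Type*} [Fintype V] [DecidableEq V]
    {M : Matrix V V ℝ} (hM : ∀ i j, 0 ≤ M i j) :
    spectralRadius ℂ (M.map (fun r : ℝ => (r : ℂ))) ≠ ⊤ := by
  refine ne_top_of_le_ne_top ENNReal.ofReal_ne_top
    (Matrix.spectralRadius_le_of_mulVec_le hM (x := fun _ => 1) (ρ := ∑ i, ∑ j, M i j)
      (fun _ => one_pos) fun i => ?_)
  simp only [Matrix.mulVec, dotProduct, mul_one]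
  exact Finset.single_le_sum (f := fun i => ∑ j, M i j)
    (fun i _ => Finset.sum_nonneg fun j _ => hM i j) (Finset.mem_univ i)

/-- If `M` is nonnegative with positive off-diagonal entries and `ρ x ≤ M x` with a strict
inequality somewhere, then `ρ` is strictly below the spectral radius. -/
theorem Matrix.lt_spectralRadius_of_smul_lt_mulVec {V : Type*} [Fintype V] [DecidableEq V]
    {M : Matrix V V ℝ} (hM : ∀ i j, 0 ≤ M i j) (hoff : ∀ i j, i ≠ j → 0 < M i j)
    {x : V → ℝ} (hx : ∀ i, 0 < x i) {ρ : ℝ} (hρ : 0 ≤ ρ) (h : ∀ i, ρ * x i ≤ (M *ᵥ x) i)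
    {i₀ : V} (hi₀ : ρ * x i₀ < (M *ᵥ x) i₀) :
    ENNReal.ofReal ρ < spectralRadius ℂ (M.map (fun r : ℝ => (r : ℂ))) := by
  have : Nonempty V := ⟨i₀⟩
  -- Raising `x i₀` by `ε` makes every row strict: the other rows gain `M i i₀ * ε > 0`, while row
  -- `i₀` gives up at most `ρ * ε`, less than its slack.
  set ε : ℝ := ((M *ᵥ x) i₀ - ρ * x i₀) / (ρ + 1) with hε
  have hε0 : 0 < ε := div_pos (sub_pos.2 hi₀) (by linarith)
  have hεle : ρ * ε < (M *ᵥ x) i₀ - ρ * x i₀ := by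
    have : (ρ + 1) * ε = (M *ᵥ x) i₀ - ρ * x i₀ := by rw [hε]; field_simp
    linarith
  set y : V → ℝ := x + Pi.single i₀ ε with hy
  have hMy : ∀ i, (M *ᵥ y) i = (M *ᵥ x) i + M i i₀ * ε := by
    intro i
    rw [hy, Matrix.mulVec_add, Pi.add_apply, Matrix.mulVec_single]
    simp
  have hy0 : ∀ i, 0 < y i := by
    intro i
    rcases eq_or_ne i i₀ with rfl | hi
    · simpa [hy] using add_pos (hx i) hε0
    · simpa [hy, hi] using hx i
  have hstrict : ∀ i, ρ < (M *ᵥ y) i / y i := by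
    intro i
    rw [lt_div_iff₀ (hy0 i), hMy]
    rcases eq_or_ne i i₀ with rfl | hi
    · have := mul_nonneg (hM i i) hε0.le
      simp only [hy, Pi.add_apply, Pi.single_eq_same]
      linarith
    · have := mul_pos (hoff i i₀ hi) hε0
      simp only [hy, Pi.add_apply, Pi.single_eq_of_ne hi]
      linarith [h i]
  obtain ⟨i₁, hi₁⟩ := Finite.exists_min (fun i => (M *ᵥ y) i / y i)
  refine lt_of_lt_of_le ?_ (Matrix.le_spectralRadius_of_smul_le_mulVec hM hy0
    (hρ.trans (hstrict i₁).le) fun i => (le_div_iff₀ (hy0 i)).1 (hi₁ i))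
  exact (ENNReal.ofReal_lt_ofReal_iff_of_nonneg hρ).2 (hstrict i₁)

/-! ### Walks and distances -/

namespace Digraph

variable {V W : Type*}

theorem HasWalk.adj_of_one {G : Digraph V} {u v : V} (h : G.HasWalk u v 1) : G.Adj u v := by
  cases h with
  | cons h p => cases p; exact h

theorem HasWalk.snoc {G : Digraph V} {u v w : V} {l : ℕ} (h : G.HasWalk u v l)
    (hvw : G.Adj v w) : G.HasWalk u w (l + 1) := by
  induction h with
  | nil u => exact .cons hvw (.nil w)
  | cons h _ ih => exact .cons h (ih hvw)

theorem HasWalk.map {G : Digraph V} {H : Digraph W} {f : V → W}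
    (hf : ∀ u v, G.Adj u v → H.Adj (f u) (f v)) {u v : V} {l : ℕ} (h : G.HasWalk u v l) :
    H.HasWalk (f u) (f v) l := by
  induction h with
  | nil u => exact .nil _
  | cons h _ ih => exact .cons (hf _ _ h) ih

theorem dist_self (G : Digraph V) (u : V) : G.dist u u = 0 :=
  Nat.sInf_eq_zero.2 (Or.inl (.nil u))

theorem StronglyConnected.hasWalk_dist {G : Digraph V} (hG : G.StronglyConnected) (u v : V) :
    G.HasWalk u v (G.dist u v) :=
  Nat.sInf_mem (s := {l | G.HasWalk u v l}) (hG u v)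

theorem StronglyConnected.one_le_dist {G : Digraph V} (hG : G.StronglyConnected) {u v : V}
    (huv : u ≠ v) : 1 ≤ G.dist u v := by
  by_contra! h
  have h1 := hG.hasWalk_dist u v
  rw [Nat.lt_one_iff.1 h] at h1
  cases h1
  exact huv rfl

theorem StronglyConnected.two_le_dist {G : Digraph V} (hG : G.StronglyConnected) {u v : V}
    (huv : u ≠ v) (hadj : ¬ G.Adj u v) : 2 ≤ G.dist u v := by
  by_contra! h
  have h1 := hG.hasWalk_dist u v
  rw [le_antisymm (Nat.lt_succ_iff.1 h) (hG.one_le_dist huv)] at h1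
  exact hadj h1.adj_of_one

theorem HasWalk.dist_le {G : Digraph V} {u v : V} {l : ℕ} (h : G.HasWalk u v l) :
    G.dist u v ≤ l :=
  Nat.sInf_le h

theorem dist_eq_one_of_adj {G : Digraph V} {u v : V} (huv : u ≠ v) (h : G.Adj u v) :
    G.dist u v = 1 := by
  have h1 : G.HasWalk u v 1 := .cons h (.nil v)
  refine le_antisymm h1.dist_le ?_
  by_contra! h0
  have h2 : G.HasWalk u v (G.dist u v) := Nat.sInf_mem (s := {l | G.HasWalk u v l}) ⟨1, h1⟩
  rw [Nat.lt_one_iff.1 h0] at h2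
  cases h2
  exact huv rfl

theorem StronglyConnected.adj_iff_dist_eq_one {G : Digraph V} (hG : G.StronglyConnected)
    (hs : G.IsSimple) {u v : V} : G.Adj u v ↔ G.dist u v = 1 := by
  refine ⟨fun h => dist_eq_one_of_adj (fun e => hs u (e ▸ h)) h, fun h => ?_⟩
  have h1 := hG.hasWalk_dist u v
  rw [h] at h1
  exact h1.adj_of_one

theorem dist_map_iso {G : Digraph V} {H : Digraph W} (e : G.Adj ≃r H.Adj) (u v : V) :
    H.dist (e u) (e v) = G.dist u v := by
  unfold dist
  congr 1
  ext l
  refine ⟨fun h => ?_, fun h => h.map fun u v => e.map_rel_iff.2⟩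
  simpa using h.map (f := e.symm) (H := G) fun u v => e.symm.map_rel_iff.2

/-! ### Monotonicity of `μ_α` in the distances -/

section Radius

variable [Fintype V] [DecidableEq V] [Fintype W] [DecidableEq W]

/-- In this form each distance carries a single weight, nonnegative for `0 ≤ α ≤ 1` and `x ≥ 0`, so
distances can be compared term by term. -/
theorem genDistMatrix_mulVec (α : ℝ) (G : Digraph V) (x : V → ℝ) (u : V) :
    (genDistMatrix α G *ᵥ x) u =
      ∑ v, (G.dist u v : ℝ) * (α * x u + (1 - α) * x v) := by
  simp only [genDistMatrix, Matrix.add_mulVec, Matrix.smul_mulVec, Pi.add_apply, Pi.smul_apply,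
    Matrix.mulVec_diagonal, smul_eq_mul, transmission]
  simp only [Matrix.mulVec, dotProduct, distMatrix, Matrix.of_apply, Finset.mul_sum,
    Finset.sum_mul, ← Finset.sum_add_distrib]
  exact Finset.sum_congr rfl fun v _ => by ring

theorem genDistMatrix_nonneg {α : ℝ} (h0 : 0 ≤ α) (h1 : α < 1) (G : Digraph V) (u v : V) :
    0 ≤ genDistMatrix α G u v := by
  have h2 : 0 ≤ 1 - α := by linarith
  have h3 : 0 ≤ Matrix.diagonal G.transmission u v := by
    rw [Matrix.diagonal_apply]
    split_ifs
    · exact Finset.sum_nonneg fun _ _ => Nat.cast_nonneg _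
    · exact le_rfl
  simp only [genDistMatrix, Matrix.add_apply, Matrix.smul_apply, smul_eq_mul, distMatrix,
    Matrix.of_apply]
  positivity

theorem StronglyConnected.genDistMatrix_pos {α : ℝ} (h1 : α < 1)
    {G : Digraph V} (hG : G.StronglyConnected) {u v : V} (huv : u ≠ v) :
    0 < genDistMatrix α G u v := by
  have h2 : 0 < 1 - α := by linarith
  have h3 : (0 : ℝ) < G.dist u v := by exact_mod_cast hG.one_le_dist huv
  simp only [genDistMatrix, Matrix.add_apply, Matrix.smul_apply, smul_eq_mul, distMatrix,
    Matrix.of_apply, Matrix.diagonal_apply_ne _ huv]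
  rw [mul_zero, zero_add]
  positivity

/-- A positive eigenvector of `D_α(G)` belongs to the eigenvalue `μ_α(G)`. -/
theorem genDistRadius_eq_of_mulVec_eq [Nonempty V] {α : ℝ} (h0 : 0 ≤ α) (h1 : α < 1)
    {G : Digraph V} {x : V → ℝ} (hx : ∀ u, 0 < x u) {ρ : ℝ} (hρ : 0 ≤ ρ)
    (h : ∀ u, (genDistMatrix α G *ᵥ x) u = ρ * x u) : G.genDistRadius α = ρ := by
  have hM := genDistMatrix_nonneg h0 h1 G
  rw [genDistRadius, le_antisymm
    (Matrix.spectralRadius_le_of_mulVec_le hM hx fun i => (h i).le)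
    (Matrix.le_spectralRadius_of_smul_le_mulVec hM hx hρ fun i => (h i).ge),
    ENNReal.toReal_ofReal hρ]

theorem genDistRadius_eq_of_isIsomorphic [Nonempty W] {α : ℝ} (h0 : 0 ≤ α) (h1 : α < 1)
    {G : Digraph V} {H : Digraph W} (hGH : G.IsIsomorphic H) {x : W → ℝ} (hx : ∀ u, 0 < x u)
    {ρ : ℝ} (hρ : 0 ≤ ρ) (h : ∀ u, (genDistMatrix α H *ᵥ x) u = ρ * x u) :
    G.genDistRadius α = ρ := by
  obtain ⟨e⟩ := hGH
  have : Nonempty V := e.toEquiv.nonempty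
  refine genDistRadius_eq_of_mulVec_eq h0 h1 (x := fun u => x (e u)) (fun u => hx _) hρ ?_
  intro u
  rw [← h, genDistMatrix_mulVec, genDistMatrix_mulVec, ← e.toEquiv.sum_comp]
  exact Finset.sum_congr rfl fun v _ => by
    rw [← dist_map_iso e]; rfl

/-- If, along a bijection of the vertices, the distances in `G` dominate those in `H`, then
`μ_α(G)` is at least the Perron eigenvalue of `D_α(H)`, with equality only if all distances
agree. -/
theorem StronglyConnected.le_genDistRadius [Nonempty V] {α : ℝ} (h0 : 0 ≤ α) (h1 : α < 1)
    {G : Digraph V} (hG : G.StronglyConnected) {H : Digraph W} (e : V ≃ W)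
    (hd : ∀ u v, H.dist (e u) (e v) ≤ G.dist u v) {x : W → ℝ} (hx : ∀ u, 0 < x u)
    {ρ : ℝ} (hρ : 0 ≤ ρ) (h : ∀ u, (genDistMatrix α H *ᵥ x) u = ρ * x u) :
    ρ ≤ G.genDistRadius α ∧
      (G.genDistRadius α = ρ → ∀ u v, H.dist (e u) (e v) = G.dist u v) := by
  have hM := genDistMatrix_nonneg h0 h1 G
  have hfin := Matrix.spectralRadius_map_ofReal_ne_top hM
  have hw : ∀ u v, 0 < α * x (e u) + (1 - α) * x (e v) := fun u v =>
    add_pos_of_nonneg_of_pos (mul_nonneg h0 (hx _).le) (mul_pos (by linarith) (hx _))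
  have hrow : ∀ u, ρ * x (e u) =
      ∑ v, (H.dist (e u) (e v) : ℝ) * (α * x (e u) + (1 - α) * x (e v)) := by
    intro u
    rw [← h, genDistMatrix_mulVec, ← e.sum_comp]
  have hterm : ∀ u v, (H.dist (e u) (e v) : ℝ) * (α * x (e u) + (1 - α) * x (e v)) ≤
      (G.dist u v : ℝ) * (α * x (e u) + (1 - α) * x (e v)) := fun u v =>
    mul_le_mul_of_nonneg_right (by exact_mod_cast hd u v) (hw u v).le
  have hle : ∀ u, ρ * x (e u) ≤ (genDistMatrix α G *ᵥ fun v => x (e v)) u := by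
    intro u
    rw [hrow, genDistMatrix_mulVec]
    exact Finset.sum_le_sum fun v _ => hterm u v
  refine ⟨(ENNReal.ofReal_le_iff_le_toReal hfin).1
    (Matrix.le_spectralRadius_of_smul_le_mulVec hM (fun v => hx (e v)) hρ hle), ?_⟩
  intro heq u v
  by_contra hne
  refine absurd heq (ne_of_gt ((ENNReal.ofReal_lt_iff_lt_toReal hρ hfin).1
    (Matrix.lt_spectralRadius_of_smul_lt_mulVec hM (fun i j => hG.genDistMatrix_pos h1)
      (fun v => hx (e v)) hρ hle (i₀ := u) ?_)))
  rw [hrow, genDistMatrix_mulVec]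
  refine Finset.sum_lt_sum (fun v _ => hterm u v) ⟨v, Finset.mem_univ v, ?_⟩
  exact mul_lt_mul_of_pos_right (by exact_mod_cast lt_of_le_of_ne (hd u v) hne) (hw u v)

end Radius

end Digraph

/-! ### Distances and Perron eigenvector of `K(n, k, m)` -/

namespace Digraph

section K

variable {n k m : ℕ}

@[simp] theorem K_adj_inl_inl (i j : Fin k) : (K n k m).Adj (.inl i) (.inl j) ↔ i ≠ j := by
  simp [K, join, loopFreeComplete]

@[simp] theorem K_adj_inl_inr (i : Fin k) (w : Fin (n - k - m) ⊕ Fin m) :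
    (K n k m).Adj (.inl i) (.inr w) := by
  simp [K, join]

@[simp] theorem K_adj_inr_inl (i : Fin k) (w : Fin (n - k - m) ⊕ Fin m) :
    (K n k m).Adj (.inr w) (.inl i) := by
  simp [K, join]

@[simp] theorem K_adj_inr_inl_inr_inl (i j : Fin (n - k - m)) :
    (K n k m).Adj (.inr (.inl i)) (.inr (.inl j)) ↔ i ≠ j := by
  simp [K, join, disjUnion, loopFreeComplete]

@[simp] theorem K_adj_inr_inr_inr_inr (i j : Fin m) :
    (K n k m).Adj (.inr (.inr i)) (.inr (.inr j)) ↔ i ≠ j := by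
  simp [K, join, disjUnion, loopFreeComplete]

@[simp] theorem K_adj_inr_inr_inr_inl (i : Fin m) (j : Fin (n - k - m)) :
    (K n k m).Adj (.inr (.inr i)) (.inr (.inl j)) := by
  simp [K]

@[simp] theorem K_not_adj_inr_inl_inr_inr (i : Fin (n - k - m)) (j : Fin m) :
    ¬ (K n k m).Adj (.inr (.inl i)) (.inr (.inr j)) := by
  simp [K, join, disjUnion]

theorem K_isSimple : (K n k m).IsSimple := by
  rintro (i | i | i) <;> simp

theorem K_dist_inr_inl_inr_inr (hk : 1 ≤ k) (i : Fin (n - k - m)) (j : Fin m) :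
    (K n k m).dist (.inr (.inl i)) (.inr (.inr j)) = 2 := by
  have h2 : (K n k m).HasWalk (.inr (.inl i)) (.inr (.inr j)) 2 :=
    .cons (K_adj_inr_inl ⟨0, hk⟩ _) (.cons (K_adj_inl_inr ⟨0, hk⟩ _) (.nil _))
  refine le_antisymm h2.dist_le ?_
  by_contra! h
  have h3 : (K n k m).HasWalk _ _ ((K n k m).dist (.inr (.inl i)) (.inr (.inr j))) :=
    Nat.sInf_mem (s := {l | (K n k m).HasWalk _ _ l}) ⟨2, h2⟩
  interval_cases (K n k m).dist (.inr (.inl i)) (.inr (.inr j))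
  · cases h3
  · exact K_not_adj_inr_inl_inr_inr i j h3.adj_of_one

theorem K_dist_le_two (hk : 1 ≤ k) (u v) : (K n k m).dist u v ≤ 2 := by
  rcases eq_or_ne u v with rfl | huv
  · simp [dist_self]
  by_cases h : (K n k m).Adj u v
  · simp [dist_eq_one_of_adj huv h]
  · have h2 : (K n k m).dist u v = 2 := by
      rcases u with i | i | i <;> rcases v with j | j | j <;> simp_all [K_dist_inr_inl_inr_inr]
    exact h2.le

/-- If `t` is a root of the quadratic in `ht`, then `n - 1 + t` is an eigenvalue of
`D_α(K(n, k, m))`, with an explicit eigenvector. -/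
theorem K_genDistMatrix_mulVec {α t : ℝ} (hk : 1 ≤ k) (hm : m + k ≤ n)
    (ht : t ^ 2 + ((1 - α) * n - α * m) * t = (1 - α) * (m * (n - k - m))) (u) :
    (genDistMatrix α (K n k m) *ᵥ
      (Sum.elim (fun _ => (1 - α) * (n - k - m : ℝ)) (Sum.elim
        (fun _ => t + (1 - α) * (n - k - m : ℝ)) (fun _ => (1 - α) * (n - k - m : ℝ))))) u =
    (n - 1 + t) *
      (Sum.elim (fun _ => (1 - α) * (n - k - m : ℝ)) (Sum.elim
        (fun _ => t + (1 - α) * (n - k - m : ℝ)) (fun _ => (1 - α) * (n - k - m : ℝ)))) u := by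
  have hc : ((n - k - m : ℕ) : ℝ) = n - k - m := by
    rw [Nat.cast_sub (by omega), Nat.cast_sub (by omega)]
  have hone : ∀ {w : ℕ} (i j : Fin w), ((if i = j then 0 else 1 : ℕ) : ℝ) =
    1 - (if i = j then 1 else 0) := fun i j => by split_ifs <;> simp
  rw [genDistMatrix_mulVec]
  have d1 : ∀ i j : Fin k, (K n k m).dist (.inl i) (.inl j) = if i = j then 0 else 1 := by
    intro i j
    split_ifs with h
    · rw [h, dist_self]
    · exact dist_eq_one_of_adj (by simpa using h) (by simpa using h)
  have d2 : ∀ i j : Fin (n - k - m), (K n k m).dist (.inr (.inl i)) (.inr (.inl j)) =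
      if i = j then 0 else 1 := by
    intro i j
    split_ifs with h
    · rw [h, dist_self]
    · exact dist_eq_one_of_adj (by simpa using h) (by simpa using h)
  have d3 : ∀ i j : Fin m, (K n k m).dist (.inr (.inr i)) (.inr (.inr j)) =
      if i = j then 0 else 1 := by
    intro i j
    split_ifs with h
    · rw [h, dist_self]
    · exact dist_eq_one_of_adj (by simpa using h) (by simpa using h)
  have d4 : ∀ (i : Fin k) w, (K n k m).dist (.inl i) (.inr w) = 1 := fun i w =>
    dist_eq_one_of_adj (by simp) (by simp)
  have d5 : ∀ (i : Fin k) w, (K n k m).dist (.inr w) (.inl i) = 1 := fun i w =>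
    dist_eq_one_of_adj (by simp) (by simp)
  have d6 : ∀ (i : Fin m) (j : Fin (n - k - m)),
      (K n k m).dist (.inr (.inr i)) (.inr (.inl j)) = 1 := fun i j =>
    dist_eq_one_of_adj (by simp) (by simp)
  have d7 := K_dist_inr_inl_inr_inr (n := n) (m := m) hk
  rw [Fintype.sum_sum_type, Fintype.sum_sum_type]
  -- Vertices of the `k`- and `m`-blocks have all distances 1, and their rows hold for every `t`.
  -- Only the `(n-k-m)`-block, at distance 2 from the `m`-block, needs the quadratic.
  rcases u with i | i | i
  · simp only [d1, d4, hone, Sum.elim_inl, Sum.elim_inr, sub_mul, one_mul,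
      Finset.sum_sub_distrib, ite_mul, zero_mul, Finset.sum_ite_eq, Finset.mem_univ, if_true,
      Finset.sum_const, Finset.card_univ, Fintype.card_fin, nsmul_eq_mul, hc, Nat.cast_one]
    ring
  · simp only [d2, d5, d7, hone, Sum.elim_inl, Sum.elim_inr, sub_mul, one_mul,
      Finset.sum_sub_distrib, ite_mul, zero_mul, Finset.sum_ite_eq, Finset.mem_univ, if_true,
      Finset.sum_const, Finset.card_univ, Fintype.card_fin, nsmul_eq_mul, hc, Nat.cast_one,
      Nat.cast_ofNat]
    linear_combination (-1) * ht
  · simp only [d3, d5, d6, hone, Sum.elim_inl, Sum.elim_inr, sub_mul, one_mul,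
      Finset.sum_sub_distrib, ite_mul, zero_mul, Finset.sum_ite_eq, Finset.mem_univ, if_true,
      Finset.sum_const, Finset.card_univ, Fintype.card_fin, nsmul_eq_mul, hc, Nat.cast_one]
    ring

theorem K_exists_pos_eigenvector {α t : ℝ} (h1 : α < 1) (hk : 1 ≤ k) (hm : m + k + 1 ≤ n)
    (ht0 : 0 < t)
    (ht : t ^ 2 + ((1 - α) * n - α * m) * t = (1 - α) * (m * (n - k - m))) :
    ∃ x, (∀ u, 0 < x u) ∧
      ∀ u, (genDistMatrix α (K n k m) *ᵥ x) u = (n - 1 + t) * x u := by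
  refine ⟨_, ?_, K_genDistMatrix_mulVec hk (by omega) ht⟩
  have h2 : (m : ℝ) + k + 1 ≤ n := by exact_mod_cast hm
  have h3 : 0 < (1 - α) * (n - k - m : ℝ) := mul_pos (by linarith) (by linarith)
  rintro (i | i | i)
  exacts [h3, add_pos ht0 h3, h3]

theorem genDistRadius_K {α t : ℝ} (h0 : 0 ≤ α) (h1 : α < 1) (hk : 1 ≤ k) (hm : m + k + 1 ≤ n)
    (ht0 : 0 < t)
    (ht : t ^ 2 + ((1 - α) * n - α * m) * t = (1 - α) * (m * (n - k - m))) :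
    genDistRadius α (K n k m) = n - 1 + t := by
  have : Nonempty (Fin k) := ⟨⟨0, hk⟩⟩
  have hn : (1 : ℝ) ≤ n := by exact_mod_cast (by omega : 1 ≤ n)
  obtain ⟨x, hx, hxe⟩ := K_exists_pos_eigenvector h1 hk hm ht0 ht
  exact genDistRadius_eq_of_mulVec_eq h0 h1 hx (by linarith) hxe

end K

/-! ### From arc cuts to spanning subdigraphs of `K(n, k, m)` -/

/-- A digraph whose arc connectivity is positive and below `card V - 1` has an arc cut of that
size, which separates a nonempty set `W` from its nonempty complement. -/
theorem exists_arcs_between {V : Type*} [Fintype V] [DecidableEq V] {G : Digraph V} {k : ℕ}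
    (hk1 : 1 ≤ k) (hk : G.arcConnectivity = k) :
    ∃ (W : Finset V) (S : Finset (V × V)), W.Nonempty ∧ Wᶜ.Nonempty ∧ S.card ≤ k ∧
      (∀ e ∈ S, e.1 ∈ W ∧ e.2 ∉ W) ∧ ∀ u ∈ W, ∀ v ∉ W, G.Adj u v → (u, v) ∈ S := by
  classical
  -- `1 ≤ k` excludes the default value `sInf ∅ = 0`.
  have hne : {c | ∃ S : Finset (V × V), G.IsArcCut S ∧ S.card = c}.Nonempty := by
    by_contra h
    rw [Set.not_nonempty_iff_eq_empty] at h
    rw [arcConnectivity, h, Nat.sInf_empty] at hk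
    omega
  obtain ⟨S, ⟨-, hS⟩, hSc⟩ := Nat.sInf_mem hne
  replace hSc : S.card = k := hSc.trans hk
  simp only [StronglyConnected, not_forall] at hS
  obtain ⟨a, b, hab⟩ := hS
  set W : Finset V := Finset.univ.filter fun w => ∃ l, (G.deleteArcs S).HasWalk a w l with hW
  have hmem : ∀ w, w ∈ W ↔ ∃ l, (G.deleteArcs S).HasWalk a w l := by simp [hW]
  refine ⟨W, S.filter fun e => e.1 ∈ W ∧ e.2 ∉ W, ⟨a, (hmem a).2 ⟨0, .nil a⟩⟩,
    ⟨b, by rw [Finset.mem_compl, hmem]; exact hab⟩,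
    (Finset.card_filter_le _ _).trans hSc.le, fun e he => (Finset.mem_filter.1 he).2, ?_⟩
  intro u hu v hv huv
  refine Finset.mem_filter.2 ⟨?_, hu, hv⟩
  by_contra hS
  obtain ⟨l, hl⟩ := (hmem u).1 hu
  exact hv ((hmem v).2 ⟨l + 1, hl.snoc ⟨huv, hS⟩⟩)

/-- If at most `k ≤ card V - 2` arcs lead from `W` to its complement, then some `k` vertices
meet all of these arcs without covering `W` or its complement. -/
theorem exists_vertex_cut {V : Type*} [Fintype V] [DecidableEq V] {G : Digraph V} {k : ℕ}
    (hkn : k + 2 ≤ Fintype.card V) {W : Finset V} {S : Finset (V × V)} (hW : W.Nonempty)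
    (hWc : Wᶜ.Nonempty) (hSk : S.card ≤ k) (hS : ∀ e ∈ S, e.1 ∈ W ∧ e.2 ∉ W)
    (hWS : ∀ u ∈ W, ∀ v ∉ W, G.Adj u v → (u, v) ∈ S) :
    ∃ R : Finset V, R.card = k ∧ (W \ R).Nonempty ∧ (Wᶜ \ R).Nonempty ∧
      ∀ u ∈ W \ R, ∀ v ∈ Wᶜ \ R, ¬ G.Adj u v := by
  -- Otherwise `|W| * |Wᶜ| ≤ k ≤ n - 2`, whereas two positive integers with sum `n` have product at
  -- least `n - 1`.
  obtain ⟨a, ha, b, hb, hab⟩ : ∃ a ∈ W, ∃ b ∈ Wᶜ, (a, b) ∉ S := by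
    by_contra! h
    have h1 : W ×ˢ Wᶜ ⊆ S := fun e he =>
      h _ (Finset.mem_product.1 he).1 _ (Finset.mem_product.1 he).2
    have h2 := Finset.card_le_card h1
    rw [Finset.card_product] at h2
    have h3 := Finset.card_add_card_compl W
    have h4 := hW.card_pos
    have h5 := hWc.card_pos
    nlinarith
  rw [Finset.mem_compl] at hb
  have hne : a ≠ b := fun h => hb (h ▸ ha)
  -- One endpoint per cut arc, avoiding both `a` and `b`: the head if the tail is `a` (it is not
  -- `b`, as `(a, b) ∉ S`), the tail otherwise. So `a` and `b` survive, also after padding to `k`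
  -- vertices.
  set R₀ := S.image fun e => if e.1 = a then e.2 else e.1 with hR₀
  have hR₀sub : R₀ ⊆ Finset.univ \ {a, b} := by
    intro w hw
    obtain ⟨⟨x, y⟩, he, rfl⟩ := Finset.mem_image.1 hw
    obtain ⟨hx, hy⟩ := hS _ he
    simp only [Finset.mem_sdiff, Finset.mem_univ, true_and, Finset.mem_insert,
      Finset.mem_singleton, not_or]
    dsimp only at hx hy ⊢
    split_ifs with h
    · subst h
      exact ⟨fun h => hy (h ▸ ha), fun h => hab (h ▸ he)⟩
    · exact ⟨h, fun h => hb (h ▸ hx)⟩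
  have hcard : (Finset.univ \ {a, b} : Finset V).card = Fintype.card V - 2 := by
    rw [Finset.card_sdiff_of_subset (Finset.subset_univ _), Finset.card_pair hne,
      Finset.card_univ]
  obtain ⟨R, hR₀R, hRsub, hRk⟩ := Finset.exists_subsuperset_card_eq hR₀sub
    (Finset.card_image_le.trans hSk) (by omega : k ≤ (Finset.univ \ {a, b} : Finset V).card)
  have haR : a ∉ R := fun h => by simpa using hRsub h
  have hbR : b ∉ R := fun h => by simpa using hRsub h
  refine ⟨R, hRk, ⟨a, by simp [ha, haR]⟩, ⟨b, by simp [hb, hbR]⟩, ?_⟩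
  intro u hu v hv huv
  simp only [Finset.mem_sdiff, Finset.mem_compl] at hu hv
  have h1 := Finset.mem_image_of_mem (fun e : V × V => if e.1 = a then e.2 else e.1)
    (hWS u hu.1 v hv.1 huv)
  dsimp only at h1
  split_ifs at h1
  · exact hv.2 (hR₀R h1)
  · exact hu.2 (hR₀R h1)

/-- A digraph with arc connectivity `k ≤ n - 2` is, up to isomorphism, a spanning subdigraph of
some `K(n, k, m)`. -/
theorem exists_equiv_K {V : Type*} [Fintype V] [DecidableEq V] {G : Digraph V} {n k : ℕ}
    (hn : Fintype.card V = n) (hk1 : 1 ≤ k) (hkn : k + 2 ≤ n) (hs : G.IsSimple)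
    (hk : G.arcConnectivity = k) :
    ∃ m, 1 ≤ m ∧ m + k + 1 ≤ n ∧ ∃ e : V ≃ Fin k ⊕ (Fin (n - k - m) ⊕ Fin m),
      ∀ u v, G.Adj u v → (K n k m).Adj (e u) (e v) := by
  subst hn
  obtain ⟨W, S, hW, hWc, hSk, hS, hWS⟩ := exists_arcs_between hk1 hk
  obtain ⟨R, hRk, hA, hB, hAB⟩ := exists_vertex_cut hkn hW hWc hSk hS hWS
  have hcard : R.card + (W \ R).card + (Wᶜ \ R).card = Fintype.card V := by
    rw [← Finset.card_univ, ← Finset.card_union_of_disjoint, ← Finset.card_union_of_disjoint]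
    · congr 1
      ext v
      by_cases v ∈ R <;> by_cases v ∈ W <;> simp [*]
    · rw [Finset.disjoint_left]
      intro v hv
      by_cases v ∈ R <;> by_cases v ∈ W <;> simp_all
    · exact Finset.disjoint_sdiff
  have hA1 := hA.card_pos
  have hB1 := hB.card_pos
  refine ⟨(Wᶜ \ R).card, hB1, by omega, ?_⟩
  set m := (Wᶜ \ R).card with hm
  let e₁ := R.equivFinOfCardEq hRk
  let e₂ := (W \ R).equivFinOfCardEq (n := Fintype.card V - k - m) (by omega)
  let e₃ := (Wᶜ \ R).equivFinOfCardEq hm.symm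
  let f : Fin k ⊕ (Fin (Fintype.card V - k - m) ⊕ Fin m) → V :=
    Sum.elim (fun i => e₁.symm i) (Sum.elim (fun i => e₂.symm i) (fun i => e₃.symm i))
  have h₁ : ∀ i, f (.inl i) ∈ R := fun i => (e₁.symm i).2
  have h₂ : ∀ i, f (.inr (.inl i)) ∈ W \ R := fun i => (e₂.symm i).2
  have h₃ : ∀ i, f (.inr (.inr i)) ∈ Wᶜ \ R := fun i => (e₃.symm i).2
  have hsurj : Function.Surjective f := by
    intro v
    by_cases hR : v ∈ R
    · exact ⟨.inl (e₁ ⟨v, hR⟩), by simp [f]⟩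
    by_cases hv : v ∈ W
    · exact ⟨.inr (.inl (e₂ ⟨v, by simp [hR, hv]⟩)), by simp [f]⟩
    · exact ⟨.inr (.inr (e₃ ⟨v, by simp [hR, hv]⟩)), by simp [f]⟩
  have hbij : Function.Bijective f := by
    rw [Fintype.bijective_iff_surjective_and_card]
    refine ⟨hsurj, ?_⟩
    simp only [Fintype.card_sum, Fintype.card_fin]
    omega
  let g := Equiv.ofBijective f hbij
  have hfg : ∀ w, g w = f w := fun _ => rfl
  refine ⟨g.symm, fun u v huv => ?_⟩
  obtain ⟨w, rfl⟩ := g.surjective u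
  obtain ⟨w', rfl⟩ := g.surjective v
  rw [g.symm_apply_apply, g.symm_apply_apply]
  have hne : w ≠ w' := fun h => hs _ (h ▸ huv)
  rcases w with i | i | i <;> rcases w' with j | j | j <;> try first | (simp; done) | simpa using hne
  exact absurd huv (hAB _ (h₂ i) _ (h₃ j))

/-- Arcs stay arcs, and nonadjacent distinct vertices of `G` are at distance at least 2, the most
that occurs in `K(n, k, m)`. -/
theorem StronglyConnected.K_dist_le {V : Type*} {G : Digraph V} {n k m : ℕ}
    (hG : G.StronglyConnected) (hk : 1 ≤ k) (e : V ≃ Fin k ⊕ (Fin (n - k - m) ⊕ Fin m))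
    (he : ∀ u v, G.Adj u v → (K n k m).Adj (e u) (e v)) (u v : V) :
    (K n k m).dist (e u) (e v) ≤ G.dist u v := by
  rcases eq_or_ne u v with rfl | huv
  · simp [dist_self]
  by_cases h : G.Adj u v
  · rw [dist_eq_one_of_adj huv h, dist_eq_one_of_adj (e.injective.ne huv) (he u v h)]
  · exact (K_dist_le_two hk _ _).trans (hG.two_le_dist huv h)

/-- Arcs are exactly the pairs at distance 1; `he` carries strong connectivity over to `H`. -/
theorem StronglyConnected.isIsomorphic_of_dist_eq {V W : Type*} {G : Digraph V} {H : Digraph W}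
    (hG : G.StronglyConnected) (hs : G.IsSimple) (hH : H.IsSimple) (e : V ≃ W)
    (he : ∀ u v, G.Adj u v → H.Adj (e u) (e v))
    (h : ∀ u v, H.dist (e u) (e v) = G.dist u v) : G.IsIsomorphic H := by
  have hHc : H.StronglyConnected := fun u v => by
    obtain ⟨l, hl⟩ := hG (e.symm u) (e.symm v)
    exact ⟨l, by simpa using hl.map he⟩
  refine ⟨⟨e, fun {u v} => ?_⟩⟩
  rw [hG.adj_iff_dist_eq_one hs, hHc.adj_iff_dist_eq_one hH, h]

end Digraph

/-! ### The positive root of the quadratic -/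

theorem exists_pos_root {b c : ℝ} (hc : 0 < c) : ∃ t : ℝ, 0 < t ∧ t ^ 2 + b * t = c := by
  have h := Real.sq_sqrt (show 0 ≤ b ^ 2 + 4 * c by positivity)
  refine ⟨(√(b ^ 2 + 4 * c) - b) / 2, ?_, by linear_combination h / 4⟩
  have : b < √(b ^ 2 + 4 * c) := Real.lt_sqrt_of_sq_lt (by linarith)
  linarith

/-- The positive root of `t ^ 2 + b t = c` decreases in `b` and increases in `c`. -/
theorem pos_root_le {b c b' c' s t : ℝ} (hs : 0 < s) (ht : 0 < t)
    (hsb : s ^ 2 + b * s = c) (htb : t ^ 2 + b' * t = c') (hb : b' ≤ b) (hc0 : 0 < c)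
    (hc : c ≤ c') :
    s ≤ t ∧ (t = s → b' = b ∧ c' = c) := by
  constructor
  · have h1 : 0 < s + b := by
      by_contra! h
      nlinarith
    -- If `t < s`, then `c' = t(t + b') ≤ t(t + b) < s(s + b) = c`, contradicting `c ≤ c'`.
    by_contra! h
    nlinarith [mul_pos (sub_pos.2 h) h1, mul_nonneg (sub_nonneg.2 hb) ht.le,
      mul_pos (sub_pos.2 h) ht]
  · rintro rfl
    have : b' = b := by
      refine le_antisymm hb ?_
      by_contra! h
      nlinarith
    subst this
    exact ⟨rfl, by linarith⟩

/-! ### Minimizing over `m` -/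

namespace Digraph

theorem genDistRadius_eq_K_of_isIsomorphic {V : Type*} [Fintype V] [DecidableEq V]
    {G : Digraph V} {n k m : ℕ} (hk1 : 1 ≤ k) (hm1 : 1 ≤ m) (hm : m + k + 1 ≤ n) {α : ℝ}
    (h0 : 0 ≤ α) (h1 : α < 1) (h : G.IsIsomorphic (K n k m)) :
    G.genDistRadius α = genDistRadius α (K n k m) := by
  have : Nonempty (Fin k) := ⟨⟨0, hk1⟩⟩
  have hn : (1 : ℝ) ≤ n := by exact_mod_cast (by omega : 1 ≤ n)
  have hm1' : (1 : ℝ) ≤ m := by exact_mod_cast hm1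
  have hm' : (m : ℝ) + k + 1 ≤ n := by exact_mod_cast hm
  obtain ⟨t, ht0, ht⟩ := exists_pos_root (b := (1 - α) * n - α * m)
    (c := (1 - α) * (m * (n - k - m)))
    (mul_pos (by linarith) (mul_pos (by linarith) (by linarith)))
  obtain ⟨x, hx, hxe⟩ := K_exists_pos_eigenvector h1 hk1 hm ht0 ht
  rw [genDistRadius_K h0 h1 hk1 hm ht0 ht,
    genDistRadius_eq_of_isIsomorphic h0 h1 h hx (by linarith) hxe]

/-- Among the digraphs with arc connectivity `k`, `K(n, k, 1)` minimizes `μ_α`. A digraph that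
attains the minimum is some `K(n, k, m)` with the same data as `K(n, k, 1)` in the quadratic for
the Perron eigenvalue. -/
theorem StronglyConnected.genDistRadius_K_le {V : Type*} [Fintype V] [DecidableEq V]
    {G : Digraph V} {n k : ℕ} (hn : Fintype.card V = n) (hk1 : 1 ≤ k) (hkn : k + 2 ≤ n)
    (hs : G.IsSimple) (hG : G.StronglyConnected) (hk : G.arcConnectivity = k) {α : ℝ}
    (h0 : 0 ≤ α) (h1 : α < 1) :
    genDistRadius α (K n k 1) ≤ G.genDistRadius α ∧
      (G.genDistRadius α = genDistRadius α (K n k 1) → ∃ m : ℕ, G.IsIsomorphic (K n k m) ∧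
        (α = 0 ∨ m = 1) ∧ (m = 1 ∨ m = n - k - 1)) := by
  obtain ⟨m, hm1, hm, e, he⟩ := exists_equiv_K hn hk1 hkn hs hk
  have : Nonempty V := Fintype.card_pos_iff.1 (by omega)
  have hn1 : (1 : ℝ) ≤ n := by exact_mod_cast (by omega : 1 ≤ n)
  have hm1' : (1 : ℝ) ≤ m := by exact_mod_cast hm1
  have hm' : (m : ℝ) + k + 1 ≤ n := by exact_mod_cast hm
  have hα : 0 < 1 - α := by linarith
  -- `m(n-k-m) - (n-k-1) = (m-1)(n-k-1-m) ≥ 0`, which vanishes only at the two extreme values of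
  -- `m`.
  have hc : (1 - α) * ((1 : ℕ) * (n - k - (1 : ℕ))) ≤ (1 - α) * (m * (n - k - m) : ℝ) := by
    refine mul_le_mul_of_nonneg_left ?_ hα.le
    push_cast
    nlinarith
  have hc0 : 0 < (1 - α) * ((1 : ℕ) * (n - k - (1 : ℕ)) : ℝ) := by
    push_cast
    exact mul_pos hα (by linarith)
  obtain ⟨s, hs0, hse⟩ := exists_pos_root (b := (1 - α) * n - α * (1 : ℕ)) hc0
  obtain ⟨t, ht0, hte⟩ := exists_pos_root (b := (1 - α) * n - α * m) (hc0.trans_le hc)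
  obtain ⟨x, hx, hxe⟩ := K_exists_pos_eigenvector h1 hk1 hm ht0 hte
  obtain ⟨hst, hst'⟩ := pos_root_le hs0 ht0 hse hte (by push_cast; nlinarith) hc0 hc
  obtain ⟨hle, heq⟩ := hG.le_genDistRadius h0 h1 e (hG.K_dist_le hk1 e he) hx
    (by linarith) hxe
  rw [genDistRadius_K h0 h1 hk1 (by omega) hs0 hse]
  refine ⟨by linarith, fun h => ?_⟩
  -- Equality forces `s = t`, hence equal coefficients: the linear one gives `α(m-1) = 0`, the
  -- constant one `(m-1)(n-k-1-m) = 0`.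
  obtain ⟨hb, hc⟩ := hst' (by linarith)
  refine ⟨m, hG.isIsomorphic_of_dist_eq hs K_isSimple e he (heq (by linarith)), ?_, ?_⟩
  · have h2 : α * ((m : ℝ) - 1) = 0 := by push_cast at hb; linarith
    refine (mul_eq_zero.1 h2).imp id fun h => ?_
    exact_mod_cast sub_eq_zero.1 h
  · have h2 : ((m : ℝ) - 1) * (n - k - 1 - m) = 0 := by
      have := mul_left_cancel₀ hα.ne' hc
      push_cast at this
      linarith
    refine (mul_eq_zero.1 h2).imp (fun h => by exact_mod_cast sub_eq_zero.1 h) fun h => ?_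
    have h3 : (n : ℝ) = k + 1 + m := by linarith
    have h4 : n = k + 1 + m := by exact_mod_cast h3
    omega

theorem genDistRadius_zero_K_one_eq {n k : ℕ} (hk1 : 1 ≤ k) (hkn : k + 2 ≤ n) :
    genDistRadius 0 (K n k 1) = genDistRadius 0 (K n k (n - k - 1)) := by
  have hkn' : (k : ℝ) + 2 ≤ n := by exact_mod_cast hkn
  have hc : ((n - k - 1 : ℕ) : ℝ) = n - k - 1 := by
    rw [Nat.cast_sub (by omega), Nat.cast_sub (by omega), Nat.cast_one]
  -- For `α = 0` the quadratic is invariant under `m ↦ n-k-m`, so both digraphs share this root.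
  obtain ⟨s, hs0, hse⟩ := exists_pos_root (b := n) (c := n - k - 1) (by linarith)
  rw [genDistRadius_K le_rfl one_pos hk1 (by omega) hs0 (by push_cast; linarith),
    genDistRadius_K le_rfl one_pos hk1 (by omega) hs0 (by rw [hc]; linarith)]

end Digraph

theorem theorem5p4 {V : Type*} [Fintype V] [DecidableEq V] (G : Digraph V) (n k : ℕ)
    (hn : Fintype.card V = n) (hk1 : 1 ≤ k) (hkn : k + 2 ≤ n)
    (hsimple : G.IsSimple) (hconn : G.StronglyConnected) (hk : G.arcConnectivity = k) :
    (Digraph.genDistRadius 0 (Digraph.K n k 1) ≤ G.genDistRadius 0 ∧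
      Digraph.genDistRadius 0 (Digraph.K n k 1) =
        Digraph.genDistRadius 0 (Digraph.K n k (n - k - 1)) ∧
      (G.genDistRadius 0 = Digraph.genDistRadius 0 (Digraph.K n k 1) ↔
        G.IsIsomorphic (Digraph.K n k (n - k - 1)) ∨ G.IsIsomorphic (Digraph.K n k 1))) ∧
    ∀ α : ℝ, 0 < α → α < 1 →
      Digraph.genDistRadius α (Digraph.K n k 1) ≤ G.genDistRadius α ∧
      (G.genDistRadius α = Digraph.genDistRadius α (Digraph.K n k 1) ↔
        G.IsIsomorphic (Digraph.K n k 1)) := by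
  obtain ⟨hle, heq⟩ := hconn.genDistRadius_K_le hn hk1 hkn hsimple hk le_rfl one_pos
  have hK := Digraph.genDistRadius_zero_K_one_eq hk1 hkn
  refine ⟨⟨hle, hK, fun h => ?_, ?_⟩, fun α h0 h1 => ?_⟩
  · obtain ⟨m, hm, -, rfl | rfl⟩ := heq h
    exacts [Or.inr hm, Or.inl hm]
  · rintro (h | h)
    · rw [hK]
      exact Digraph.genDistRadius_eq_K_of_isIsomorphic hk1 (by omega) (by omega) le_rfl one_pos h
    · exact Digraph.genDistRadius_eq_K_of_isIsomorphic hk1 le_rfl (by omega) le_rfl one_pos h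
  · obtain ⟨hle, heq⟩ := hconn.genDistRadius_K_le hn hk1 hkn hsimple hk h0.le h1
    refine ⟨hle, fun h => ?_,
      Digraph.genDistRadius_eq_K_of_isIsomorphic hk1 le_rfl (by omega) h0.le h1⟩
    obtain ⟨m, hm, rfl | rfl, -⟩ := heq h
    exacts [absurd h0 (lt_irrefl 0), hm]
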